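/- Let $V$ be a finite set with $n\ge 4$ elements and let $E$ be the index set of $n-3$ hyperedges, each of which is a $4$-element subset of $V$; write $\mathcal T=(V,E)$ for this 4-uniform hypergraph. For distinct points $z_1,z_2,z_3,z_4\in\mathbb P^1=\mathbb P^1(\mathbb C)$ put $$\mathrm{CR}(z_1,z_2,z_3,z_4)=\frac{(z_3-z_1)(z_4-z_2)}{(z_3-z_2)(z_4-z_1)}\in\mathbb C\setminus\{0,1\},$$ extended as usual when one of the points is $\infty$. Let $M_{0,V}$ be the variety of families $(z_v)_{v\in V}$ of distinct points of $\mathbb P^1$ up to Möbius transformations. Choose an ordering $(v_{e,1},v_{e,2},v_{e,3},v_{e,4})$ of each hyperedge $e$, and let $\mathrm{CR}_{\mathcal T}:M_{0,V}\to(\mathbb C\setminus\{0,1\})^{E}$ be the map with components $\mathrm{CR}(z_{v_{e,1}},z_{v_{e,2}},z_{v_{e,3}},z_{v_{e,4}})$. The cross-ratio degree $d_{\mathcal T}$ is the degree of $\mathrm{CR}_{\mathcal T}$, i.e. the number of points of $\mathrm{CR}_{\mathcal T}^{-1}(a)$ for a general $a\in(\mathbb C\setminus\{0,1\})^E$ (it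 is $0$ if $\mathrm{CR}_{\mathcal T}$ is not dominant). Let $v_1,v_2,v_3\in V$ be distinct, and let $\mathcal T'$ be the hypergraph with vertex set $V'=V\sqcup\{n+1\}$, where $n+1$ is a new vertex, whose hyperedges are those of $\mathcal T$ together with one new hyperedge $e'=\{v_1,v_2,v_3,n+1\}$. Then, whichever orderings of the hyperedges of $\mathcal T$ and of $\mathcal T'$ are chosen, $$d_{\mathcal T}=d_{\mathcal T'}.$$ -/

import Mathlib

open scoped LinearAlgebra.Projectivization MatrixGroups

namespace CrossRatioDegree

/-- The complex projective line `ℙ¹`. -/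
abbrev P1 : Type := ℙ ℂ (Fin 2 → ℂ)

/-- The bracket `x₀ y₁ - x₁ y₀`; for `x = (z, 1)` and `y = (w, 1)` it is `z - w`. -/
def bracket (x y : Fin 2 → ℂ) : ℂ := x 0 * y 1 - x 1 * y 0

/-- The cross-ratio `((z₃ - z₁) (z₄ - z₂)) / ((z₃ - z₂) (z₄ - z₁))` of four points of `ℙ¹`,
written in homogeneous coordinates, so that the point at infinity needs no special treatment.
It is used for distinct points only. -/
noncomputable def crossRatio (z₁ z₂ z₃ z₄ : P1) : ℂ :=
  (bracket z₃.rep z₁.rep * bracket z₄.rep z₂.rep) /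
    (bracket z₃.rep z₂.rep * bracket z₄.rep z₁.rep)

/-- `ℂ ∖ {0, 1}`. -/
abbrev CC : Type := {c : ℂ // c ≠ 0 ∧ c ≠ 1}

/-- The cross-ratio does not depend on the homogeneous coordinates chosen. -/
theorem crossRatio_mk (x₁ x₂ x₃ x₄ : Fin 2 → ℂ)
    (h₁ : x₁ ≠ 0) (h₂ : x₂ ≠ 0) (h₃ : x₃ ≠ 0) (h₄ : x₄ ≠ 0) :
    crossRatio (Projectivization.mk ℂ x₁ h₁) (Projectivization.mk ℂ x₂ h₂)
      (Projectivization.mk ℂ x₃ h₃) (Projectivization.mk ℂ x₄ h₄) =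
    (bracket x₃ x₁ * bracket x₄ x₂) / (bracket x₃ x₂ * bracket x₄ x₁) := by
  obtain ⟨a₁, e₁⟩ := Projectivization.exists_smul_eq_mk_rep ℂ x₁ h₁
  obtain ⟨a₂, e₂⟩ := Projectivization.exists_smul_eq_mk_rep ℂ x₂ h₂
  obtain ⟨a₃, e₃⟩ := Projectivization.exists_smul_eq_mk_rep ℂ x₃ h₃
  obtain ⟨a₄, e₄⟩ := Projectivization.exists_smul_eq_mk_rep ℂ x₄ h₄
  have key : ∀ (a b : ℂˣ) (x y : Fin 2 → ℂ),
      bracket (a • x) (b • y) = (a * b : ℂ) * bracket x y := by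
    intro a b x y
    simp only [bracket, Pi.smul_apply, Units.smul_def, smul_eq_mul]
    ring
  rw [crossRatio, ← e₁, ← e₂, ← e₃, ← e₄, key, key, key, key]
  have hc : (a₁ * a₂ * a₃ * a₄ : ℂ) ≠ 0 := by simp
  rw [← mul_div_mul_left (bracket x₃ x₁ * bracket x₄ x₂) _ hc]
  congr 1 <;> ring

theorem bracket_rep_ne_zero {z w : P1} (h : z ≠ w) : bracket z.rep w.rep ≠ 0 := by
  intro h0
  apply h
  rw [← z.mk_rep, ← w.mk_rep, Projectivization.mk_eq_mk_iff']
  have h0' : z.rep 0 * w.rep 1 = z.rep 1 * w.rep 0 := sub_eq_zero.mp h0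
  by_cases hw : w.rep 0 = 0
  · have hw1 : w.rep 1 ≠ 0 := by
      intro h1
      apply w.rep_nonzero
      ext i
      fin_cases i <;> simp [hw, h1]
    have hz : z.rep 0 = 0 := by
      rw [hw, mul_zero] at h0'
      exact (mul_eq_zero.mp h0').resolve_right hw1
    refine ⟨z.rep 1 / w.rep 1, ?_⟩
    ext i
    fin_cases i
    · simp [hw, hz]
    · simp [hw1]
  · refine ⟨z.rep 0 / w.rep 0, ?_⟩
    ext i
    fin_cases i
    · simp [hw]
    · simp only [Fin.mk_one, Pi.smul_apply, smul_eq_mul]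
      rw [div_mul_eq_mul_div, h0', mul_div_assoc, div_self hw, mul_one]

/-- The cross-ratio of four distinct points lies in `ℂ ∖ {0, 1}`. -/
theorem crossRatio_mem (z : Fin 4 ↪ P1) :
    crossRatio (z 0) (z 1) (z 2) (z 3) ≠ 0 ∧ crossRatio (z 0) (z 1) (z 2) (z 3) ≠ 1 := by
  have hb : ∀ i j : Fin 4, i ≠ j → bracket (z i).rep (z j).rep ≠ 0 :=
    fun i j h => bracket_rep_ne_zero (fun h' => h (z.injective h'))
  have h20 := hb 2 0 (by decide)
  have h31 := hb 3 1 (by decide)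
  have h21 := hb 2 1 (by decide)
  have h30 := hb 3 0 (by decide)
  refine ⟨div_ne_zero (mul_ne_zero h20 h31) (mul_ne_zero h21 h30), fun h => ?_⟩
  rw [crossRatio, div_eq_one_iff_eq (mul_ne_zero h21 h30)] at h
  refine mul_ne_zero (hb 1 0 (by decide)) (hb 3 2 (by decide)) ?_
  simp only [bracket] at h ⊢
  linear_combination h

/-- The cross-ratio is invariant under Möbius transformations. -/
theorem crossRatio_smul (g : GL (Fin 2) ℂ) (z₁ z₂ z₃ z₄ : P1) :
    crossRatio (g • z₁) (g • z₂) (g • z₃) (g • z₄) = crossRatio z₁ z₂ z₃ z₄ := by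
  induction z₁ using Projectivization.ind with | h x₁ h₁ => ?_
  induction z₂ using Projectivization.ind with | h x₂ h₂ => ?_
  induction z₃ using Projectivization.ind with | h x₃ h₃ => ?_
  induction z₄ using Projectivization.ind with | h x₄ h₄ => ?_
  have key : ∀ x y : Fin 2 → ℂ, bracket (g • x) (g • y) = g.val.det * bracket x y := by
    intro x y
    have hs : ∀ w : Fin 2 → ℂ, g • w = g.val.mulVec w := fun _ => rfl
    simp only [bracket, hs, Matrix.mulVec, dotProduct, Fin.sum_univ_two, Matrix.det_fin_two]
    ring
  simp only [Projectivization.smul_mk]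
  rw [crossRatio_mk, crossRatio_mk, key, key, key, key]
  have hg : g.val.det ≠ 0 := g.isUnit.map Matrix.detMonoidHom |>.ne_zero
  rw [← mul_div_mul_left (bracket x₃ x₁ * bracket x₄ x₂) _ (mul_ne_zero hg hg)]
  congr 1 <;> ring

/-- The (complex points of the) moduli space `M_{0,V}`: families of distinct points of `ℙ¹`
indexed by `V`, up to Möbius transformations. -/
abbrev M0 (V : Type*) : Type _ := MulAction.orbitRel.Quotient (GL (Fin 2) ℂ) (V ↪ P1)

/-- The map `CR_T : M_{0,V} → (ℂ ∖ {0, 1})^E` of a family `T` of ordered 4-tuples of distinct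
elements of `V`. -/
noncomputable def crossRatioMap {V E : Type*} (T : E → (Fin 4 ↪ V)) : M0 V → (E → CC) :=
  Quotient.lift
    (fun z e => ⟨crossRatio (z (T e 0)) (z (T e 1)) (z (T e 2)) (z (T e 3)),
      crossRatio_mem ((T e).trans z)⟩)
    (by
      rintro _ z ⟨g, rfl⟩
      funext e
      exact Subtype.ext (crossRatio_smul g _ _ _ _))

/-- `d` is the degree of `CR_T`: the fibre over a general point of `(ℂ ∖ {0, 1})^E`, that is, over
each point of some nonempty Zariski-open subset, has exactly `d` points. (If `CR_T` is not
dominant, the general fibre is empty and `d = 0`.) -/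
def IsDegree {V E : Type*} (T : E → (Fin 4 ↪ V)) (d : ℕ) : Prop :=
  ∃ p : MvPolynomial E ℂ, p ≠ 0 ∧
    ∀ a : E → CC, MvPolynomial.eval (fun e => (a e : ℂ)) p ≠ 0 →
      {x : M0 V | crossRatioMap T x = a}.encard = d

/-- The degree is unique: two nonempty Zariski-open subsets of `(ℂ ∖ {0, 1})^E` meet. -/
theorem IsDegree.unique {V E : Type*} [Fintype E] {T : E → (Fin 4 ↪ V)} {d d' : ℕ}
    (h : IsDegree T d) (h' : IsDegree T d') : d = d' := by
  obtain ⟨p, hp, hd⟩ := h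
  obtain ⟨q, hq, hd'⟩ := h'
  have hX : ∀ c : ℂ, ∀ e : E, (MvPolynomial.X e - MvPolynomial.C c : MvPolynomial E ℂ) ≠ 0 := by
    intro c e h0
    have h1 := congrArg (MvPolynomial.eval (fun _ => c + 1)) h0
    simp at h1
  have hr : p * q * ∏ e : E, ((MvPolynomial.X e - MvPolynomial.C 0) *
      (MvPolynomial.X e - MvPolynomial.C 1)) ≠ 0 :=
    mul_ne_zero (mul_ne_zero hp hq)
      (Finset.prod_ne_zero_iff.mpr fun e _ => mul_ne_zero (hX 0 e) (hX 1 e))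
  obtain ⟨a, ha⟩ : ∃ a : E → ℂ, MvPolynomial.eval a (p * q * ∏ e : E,
      ((MvPolynomial.X e - MvPolynomial.C 0) * (MvPolynomial.X e - MvPolynomial.C 1))) ≠ 0 := by
    by_contra hcon
    push Not at hcon
    exact hr (MvPolynomial.funext fun a => by rw [hcon a, map_zero])
  rw [map_mul, map_mul, map_prod, mul_ne_zero_iff, mul_ne_zero_iff, Finset.prod_ne_zero_iff] at ha
  have hc : ∀ e, a e ≠ 0 ∧ a e ≠ 1 := by
    intro e
    have he := ha.2 e (Finset.mem_univ e)
    simp only [map_mul, map_sub, MvPolynomial.eval_X, MvPolynomial.eval_C, sub_zero] at he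
    exact ⟨left_ne_zero_of_mul he, sub_ne_zero.mp (right_ne_zero_of_mul he)⟩
  have e1 := hd (fun e => ⟨a e, hc e⟩) ha.1.1
  have e2 := hd' (fun e => ⟨a e, hc e⟩) ha.1.2
  exact_mod_cast e1.symm.trans e2

open Classical in
/-- The cross-ratio degree `d_T`: the number of points in a general fibre of `CR_T`. When
`|V| = |E| + 3` is finite, source and target are irreducible varieties of the same dimension, so a
general fibre is finite of constant cardinality and the alternative `0` below never occurs. -/
noncomputable def crossRatioDegree {V E : Type*} (T : E → (Fin 4 ↪ V)) : ℕ :=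
  if h : ∃ d, IsDegree T d then h.choose else 0

end CrossRatioDegree

/-! Forgetting the new point identifies the fibres of `CR_T'` and `CR_T` over a general value.
Given the old points, the new one is determined by the cross-ratio it forms with `z_{v₁}`,
`z_{v₂}`, `z_{v₃}`, and it is distinct from them unless the prescribed value of this cross-ratio is
already taken by `CR(z_{v₁}, z_{v₂}, z_{v₃}, z_v)` for some old `v`. Such a collision happens only
over a hypersurface: for each `v` the `|E| + 1 > |V| - 3` cross-ratios in question are rational
functions of `|V| - 3` parameters, hence algebraically dependent. Reordering a hyperedge changes its
cross-ratio by a fractional linear bijection of `ℂ ∖ {0, 1}`, which preserves genericity. -/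

namespace CrossRatioDegree

open MvPolynomial

section RationalFunctions

/- The fractions with numerators in `A` and denominators outside `ker f` form a subring of `K` to
which `f` extends, and both sides of the hypothesis live there. -/
theorem map_mul_aeval_div_eq {k A K L ι : Type*} [CommRing k] [CommRing A] [Algebra k A]
    [Field K] [Algebra A K] [IsFractionRing A K] [Algebra k K] [IsScalarTower k A K]
    [Field L] [Algebra k L]
    (f : A →ₐ[k] L) {N D : ι → A} (hD : ∀ i, f (D i) ≠ 0) {P : MvPolynomial ι k} {n d : A}
    (h : algebraMap A K d * aeval (fun i => algebraMap A K (N i) / algebraMap A K (D i)) P =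
      algebraMap A K n) :
    f d * aeval (fun i => f (N i) / f (D i)) P = f n := by
  have : IsDomain A := (IsFractionRing.injective A K).isDomain (algebraMap A K)
  let M : Submonoid A := (nonZeroDivisors L).comap f
  have mem_M {x : A} : x ∈ M ↔ f x ≠ 0 := mem_nonZeroDivisors_iff_ne_zero
  have hM : M ≤ nonZeroDivisors A :=
    le_nonZeroDivisors_of_noZeroDivisors fun h0 => mem_M.mp h0 (map_zero f)
  have isUnit_K (s : M) : IsUnit (Algebra.algHom k A K s) :=
    IsLocalization.map_units K (⟨s, hM s.2⟩ : nonZeroDivisors A)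
  have isUnit_L (s : M) : IsUnit (f s) := (mem_M.mp s.2).isUnit
  let toK : Localization M →ₐ[k] K := IsLocalization.liftAlgHom isUnit_K
  let toL : Localization M →ₐ[k] L := IsLocalization.liftAlgHom isUnit_L
  let denom (i : ι) : M := ⟨D i, mem_M.mpr (hD i)⟩
  let y (i : ι) : Localization M := IsLocalization.mk' _ (N i) (denom i)
  have toK_algebraMap (a : A) : toK (algebraMap A _ a) = algebraMap A K a :=
    IsLocalization.lift_eq _ a
  have toL_algebraMap (a : A) : toL (algebraMap A _ a) = f a := IsLocalization.lift_eq _ a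
  have toK_y (i : ι) : toK (y i) = algebraMap A K (N i) / algebraMap A K (D i) :=
    eq_div_of_mul_eq (isUnit_K (denom i)).ne_zero <| by
      rw [← toK_algebraMap, ← toK_algebraMap, ← map_mul]
      exact congrArg toK (IsLocalization.mk'_spec _ _ _)
  have toL_y (i : ι) : toL (y i) = f (N i) / f (D i) :=
    eq_div_of_mul_eq (hD i) <| by
      rw [← toL_algebraMap, ← toL_algebraMap, ← map_mul]
      exact congrArg toL (IsLocalization.mk'_spec _ _ _)
  have toK_injective : Function.Injective toK := by
    refine (IsLocalization.lift_injective_iff isUnit_K).mpr fun a b => ?_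
    exact (IsLocalization.injective _ hM).eq_iff.trans (IsFractionRing.injective A K).eq_iff.symm
  have toK_aeval : toK (aeval y P) =
      aeval (fun i => algebraMap A K (N i) / algebraMap A K (D i)) P := by
    simp only [comp_aeval_apply, toK_y]
  have toL_aeval : toL (aeval y P) = aeval (fun i => f (N i) / f (D i)) P := by
    simp only [comp_aeval_apply, toL_y]
  have key : algebraMap A (Localization M) d * aeval y P = algebraMap A (Localization M) n :=
    toK_injective (by rw [map_mul, toK_algebraMap, toK_algebraMap, toK_aeval, h])
  rw [← toL_aeval, ← toL_algebraMap, ← toL_algebraMap, ← map_mul, key]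

theorem trdeg_fractionRing (k A : Type*) [CommRing k] [CommRing A] [IsDomain A] [Algebra k A]
    [FaithfulSMul k A] : Algebra.trdeg k (FractionRing A) = Algebra.trdeg k A := by
  have : IsDomain k := (FaithfulSMul.algebraMap_injective k A).isDomain (algebraMap k A)
  have := IsLocalization.isAlgebraic (S := FractionRing A) (nonZeroDivisors A)
  rw [← trdeg_add_eq k A, trdeg_eq_zero (R := A), add_zero]

theorem card_le_of_algebraicIndependent {k W ι : Type*} [CommRing k] [IsDomain k]
    {x : ι → FractionRing (MvPolynomial W k)} (hx : AlgebraicIndependent k x) :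
    ENat.card ι ≤ ENat.card W := by
  have h := hx.lift_cardinalMk_le_trdeg
  rw [trdeg_fractionRing, MvPolynomial.trdeg_of_isDomain] at h
  simpa [ENat.card] using Cardinal.toENat.monotone' h

theorem exists_relation_of_card_lt {k W ι : Type*} [Field k] (h : ENat.card W < ENat.card ι)
    (N D : ι → MvPolynomial W k) :
    ∃ P : MvPolynomial ι k, P ≠ 0 ∧ ∀ t : W → k, (∀ i, eval t (D i) ≠ 0) →
      eval (fun i => eval t (N i) / eval t (D i)) P = 0 := by
  let K := FractionRing (MvPolynomial W k)
  have dependent : ¬ AlgebraicIndependent k fun i => algebraMap _ K (N i) / algebraMap _ K (D i) :=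
    fun hx => (card_le_of_algebraicIndependent hx).not_gt h
  rw [algebraicIndependent_iff] at dependent
  push Not at dependent
  obtain ⟨P, hP, hP0⟩ := dependent
  refine ⟨P, hP0, fun t ht => ?_⟩
  have := map_mul_aeval_div_eq (K := K) (aeval t) (N := N) (D := D) (P := P) (d := 1) (n := 0) ht
    (by simp [hP, K])
  simpa [aeval_eq_eval] using this

theorem exists_eval_elim_ne_zero {R ι : Type*} [CommRing R] [IsDomain R] {s : Set R}
    (hs : s.Infinite) {q : MvPolynomial (Option ι) R} (hq : q ≠ 0) :
    ∃ p : MvPolynomial ι R, p ≠ 0 ∧ ∀ a : ι → R, eval a p ≠ 0 →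
      ∃ b ∈ s, eval (fun o => o.elim b a) q ≠ 0 := by
  let Q := optionEquivLeft R ι q
  have hQ : Q ≠ 0 := (EmbeddingLike.map_ne_zero_iff).mpr hq
  refine ⟨Q.leadingCoeff, Polynomial.leadingCoeff_ne_zero.mpr hQ, fun a ha => ?_⟩
  by_contra! vanishes
  have : Q.map (eval a) = 0 := Polynomial.eq_zero_of_infinite_isRoot _ <|
    hs.mono fun b hb => by
      simpa [optionEquivLeft_elim_eval] using vanishes b hb
  exact ha (by rw [Polynomial.leadingCoeff, ← Polynomial.coeff_map, this, Polynomial.coeff_zero])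

end RationalFunctions

section PuncturedLine

theorem infinite_setOf_ne_zero_and_ne_one : {c : ℂ | c ≠ 0 ∧ c ≠ 1}.Infinite := by
  simpa [Set.compl_def] using (Set.toFinite {(0 : ℂ), 1}).infinite_compl

theorem exists_eval_coe_ne_zero {ι : Type*} {p : MvPolynomial ι ℂ} (hp : p ≠ 0) :
    ∃ a : ι → CC, eval (fun i => (a i : ℂ)) p ≠ 0 := by
  contrapose! hp
  refine funext_set (fun _ => {c : ℂ | c ≠ 0 ∧ c ≠ 1})
    (fun _ => infinite_setOf_ne_zero_and_ne_one) fun x hx => ?_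
  rw [map_zero, ← hp fun i => ⟨x i, hx i trivial⟩]

/-- A self-map of `ℂ ∖ {0, 1}` given by a fractional linear expression, as are the maps by which
cross-ratios change when their points are reordered. -/
def IsFractionalLinear (f : CC → CC) : Prop :=
  ∃ α β γ δ : ℂ, ∀ c : CC, γ * c + δ ≠ 0 ∧ (f c : ℂ) = (α * c + β) / (γ * c + δ)

theorem IsFractionalLinear.comp {f g : CC → CC} (hf : IsFractionalLinear f)
    (hg : IsFractionalLinear g) : IsFractionalLinear (f ∘ g) := by
  obtain ⟨α, β, γ, δ, hf⟩ := hf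
  obtain ⟨α', β', γ', δ', hg⟩ := hg
  refine ⟨α * α' + β * γ', α * β' + β * δ', γ * α' + δ * γ', γ * β' + δ * δ', fun c => ?_⟩
  obtain ⟨hfden, hfg⟩ := hf (g c)
  obtain ⟨hgden, hgc⟩ := hg c
  have den_eq : (γ * α' + δ * γ') * (c : ℂ) + (γ * β' + δ * δ') =
      (γ * g c + δ) * (γ' * c + δ') := by
    rw [hgc]; field_simp; ring
  have num_eq : (α * α' + β * γ') * (c : ℂ) + (α * β' + β * δ') =
      (α * g c + β) * (γ' * c + δ') := by
    rw [hgc]; field_simp; ring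
  refine ⟨den_eq ▸ mul_ne_zero hfden hgden, ?_⟩
  rw [den_eq, num_eq, mul_div_mul_right _ _ hgden]
  exact hfg

theorem exists_polynomial_pullback {ι : Type*} {Φ : ι → CC → CC}
    (hΦ : ∀ i, IsFractionalLinear (Φ i)) (surj : ∀ i, Function.Surjective (Φ i))
    {p : MvPolynomial ι ℂ} (hp : p ≠ 0) :
    ∃ q : MvPolynomial ι ℂ, q ≠ 0 ∧ ∀ a : ι → CC, eval (fun i => (a i : ℂ)) q ≠ 0 →
      eval (fun i => (Φ i (a i) : ℂ)) p ≠ 0 := by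
  choose α β γ δ hden hΦ using hΦ
  let K := FractionRing (MvPolynomial ι ℂ)
  let N (i : ι) : MvPolynomial ι ℂ := C (α i) * X i + C (β i)
  let D (i : ι) : MvPolynomial ι ℂ := C (γ i) * X i + C (δ i)
  have clear {n d : MvPolynomial ι ℂ} (h : algebraMap _ K d *
      aeval (fun i => algebraMap _ K (N i) / algebraMap _ K (D i)) p = algebraMap _ K n)
      (a : ι → CC) :
      eval (fun i => (a i : ℂ)) d * eval (fun i => (Φ i (a i) : ℂ)) p =
        eval (fun i => (a i : ℂ)) n := by
    simpa [N, D, aeval_eq_eval, hΦ] using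
      map_mul_aeval_div_eq (aeval fun i => (a i : ℂ)) (by simpa [D] using fun i => hden i (a i)) h
  obtain ⟨n, d, hd, hnd⟩ := IsFractionRing.div_surjective (A := MvPolynomial ι ℂ)
    (aeval (fun i => algebraMap _ K (N i) / algebraMap _ K (D i)) p)
  have hn : n ≠ 0 := by
    rintro rfl
    obtain ⟨b, hb⟩ := exists_eval_coe_ne_zero hp
    choose a ha using fun i => surj i (b i)
    apply hb
    simpa [ha] using clear (n := 0) (d := 1) (by simp [← hnd]) a
  refine ⟨n, hn, fun a ha h0 => ha ?_⟩
  rw [← clear (d := d) ?_ a, h0, mul_zero]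
  rw [← hnd, mul_div_cancel₀]
  simpa using nonZeroDivisors.ne_zero hd

end PuncturedLine

section Reordering

/-- The cross-ratio of an ordered quadruple of distinct points. -/
noncomputable def quadCrossRatio (z : Fin 4 ↪ P1) : CC :=
  ⟨crossRatio (z 0) (z 1) (z 2) (z 3), crossRatio_mem z⟩

theorem crossRatioMap_mk {V E : Type*} (T : E → (Fin 4 ↪ V)) (z : V ↪ P1) :
    crossRatioMap T (Quotient.mk _ z) = fun e => quadCrossRatio ((T e).trans z) :=
  rfl

theorem crossRatioMap_comp {V E E' : Type*} (T : E → (Fin 4 ↪ V)) (f : E' → E) (x : M0 V) :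
    crossRatioMap (T ∘ f) x = crossRatioMap T x ∘ f := by
  induction x using Quotient.inductionOn with | h z => rfl

/-- `c ↦ c⁻¹` on `ℂ ∖ {0, 1}`: the effect on cross-ratios of exchanging the first two, or the last
two, points. -/
noncomputable def invPerm : Equiv.Perm CC :=
  Function.Involutive.toPerm (fun c => ⟨(c : ℂ)⁻¹, inv_ne_zero c.2.1, inv_ne_one.mpr c.2.2⟩)
    fun c => Subtype.ext (inv_inv (c : ℂ))

/-- `c ↦ 1 - c` on `ℂ ∖ {0, 1}`: the effect on cross-ratios of exchanging the two middle points. -/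
noncomputable def oneSubPerm : Equiv.Perm CC :=
  Function.Involutive.toPerm
    (fun c => ⟨1 - (c : ℂ), sub_ne_zero.mpr c.2.2.symm, fun h => c.2.1 (sub_eq_self.mp h)⟩)
    fun c => Subtype.ext (sub_sub_cancel 1 (c : ℂ))

theorem isFractionalLinear_invPerm : IsFractionalLinear invPerm :=
  ⟨0, 1, 1, 0, fun c => ⟨by simpa using c.2.1, (show (c : ℂ)⁻¹ = _ by simp)⟩⟩

theorem isFractionalLinear_oneSubPerm : IsFractionalLinear oneSubPerm :=
  ⟨-1, 1, 0, 1, fun c => ⟨by simp, (show 1 - (c : ℂ) = _ by ring)⟩⟩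

theorem crossRatio_swap_left (z₁ z₂ z₃ z₄ : P1) :
    crossRatio z₂ z₁ z₃ z₄ = (crossRatio z₁ z₂ z₃ z₄)⁻¹ :=
  (inv_div _ _).symm

theorem crossRatio_swap_right (z₁ z₂ z₃ z₄ : P1) :
    crossRatio z₁ z₂ z₄ z₃ = (crossRatio z₁ z₂ z₃ z₄)⁻¹ := by
  rw [crossRatio, crossRatio, inv_div]
  ring

theorem crossRatio_swap_middle {z₁ z₂ z₃ z₄ : P1} (h₂₃ : z₂ ≠ z₃) (h₁₄ : z₁ ≠ z₄) :
    crossRatio z₁ z₃ z₂ z₄ = 1 - crossRatio z₁ z₂ z₃ z₄ := by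
  have b₂₃ := bracket_rep_ne_zero h₂₃
  have b₃₂ := bracket_rep_ne_zero h₂₃.symm
  have b₄₁ := bracket_rep_ne_zero h₁₄.symm
  rw [crossRatio, crossRatio]
  field_simp
  simp only [bracket]
  ring

theorem exists_perm_quadCrossRatio_swap (i : Fin 3) :
    ∃ Φ : Equiv.Perm CC, IsFractionalLinear Φ ∧ ∀ z : Fin 4 ↪ P1,
      quadCrossRatio ((Equiv.swap i.castSucc i.succ).toEmbedding.trans z) =
        Φ (quadCrossRatio z) := by
  fin_cases i
  · exact ⟨invPerm, isFractionalLinear_invPerm, fun z =>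
      Subtype.ext (crossRatio_swap_left (z 0) (z 1) (z 2) (z 3))⟩
  · exact ⟨oneSubPerm, isFractionalLinear_oneSubPerm, fun z =>
      Subtype.ext (crossRatio_swap_middle (z.injective.ne (by decide : (1 : Fin 4) ≠ 2))
        (z.injective.ne (by decide : (0 : Fin 4) ≠ 3)))⟩
  · exact ⟨invPerm, isFractionalLinear_invPerm, fun z =>
      Subtype.ext (crossRatio_swap_right (z 0) (z 1) (z 2) (z 3))⟩

theorem exists_perm_quadCrossRatio (σ : Equiv.Perm (Fin 4)) :
    ∃ Φ : Equiv.Perm CC, IsFractionalLinear Φ ∧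
      ∀ z : Fin 4 ↪ P1, quadCrossRatio (σ.toEmbedding.trans z) = Φ (quadCrossRatio z) := by
  have hσ : σ ∈ Submonoid.closure (Set.range fun i : Fin 3 => Equiv.swap i.castSucc i.succ) :=
    Equiv.Perm.mclosure_swap_castSucc_succ 3 ▸ Submonoid.mem_top σ
  induction hσ using Submonoid.closure_induction with
  | mem σ hσ =>
    obtain ⟨i, rfl⟩ := hσ
    exact exists_perm_quadCrossRatio_swap i
  | one => exact ⟨1, ⟨1, 0, 0, 1, fun c => by simp⟩, fun z => rfl⟩
  | mul σ τ _ _ hσ hτ =>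
    obtain ⟨Φ, hΦ, hσΦ⟩ := hσ
    obtain ⟨Ψ, hΨ, hτΨ⟩ := hτ
    refine ⟨Ψ * Φ, hΨ.comp hΦ, fun z => ?_⟩
    rw [Equiv.Perm.mul_apply, ← hσΦ, ← hτΨ]
    rfl

theorem exists_perm_trans_eq_of_range_eq {α β : Type*} {f g : α ↪ β}
    (h : Set.range f = Set.range g) : ∃ σ : Equiv.Perm α, σ.toEmbedding.trans g = f := by
  refine ⟨(Equiv.ofInjective f f.injective).trans <|
    (Equiv.setCongr h).trans (Equiv.ofInjective g g.injective).symm, ?_⟩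
  ext x
  exact Equiv.apply_ofInjective_symm g.injective _

variable {V E : Type*} {T T' : E → (Fin 4 ↪ V)}

theorem IsDegree.of_range_eq {d : ℕ} (h : IsDegree T' d)
    (hT : ∀ e, Set.range (T e) = Set.range (T' e)) : IsDegree T d := by
  choose σ hσ using fun e => exists_perm_trans_eq_of_range_eq (hT e).symm
  choose Φ hΦ hΦσ using fun e => exists_perm_quadCrossRatio (σ e)
  obtain ⟨p, hp, hd⟩ := h
  obtain ⟨q, hq, hqp⟩ := exists_polynomial_pullback hΦ (fun e => (Φ e).surjective) hp
  have crossRatioMap_eq (x : M0 V) : crossRatioMap T' x = fun e => Φ e (crossRatioMap T x e) := by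
    induction x using Quotient.inductionOn with | h z => ?_
    simp only [crossRatioMap_mk, ← hΦσ, ← hσ]
    rfl
  refine ⟨q, hq, fun a ha => ?_⟩
  rw [← hd (fun e => Φ e (a e)) (hqp a ha)]
  simp only [crossRatioMap_eq, funext_iff, EmbeddingLike.apply_eq_iff_eq]

theorem isDegree_congr_of_range_eq (hT : ∀ e, Set.range (T e) = Set.range (T' e)) (d : ℕ) :
    IsDegree T d ↔ IsDegree T' d :=
  ⟨fun h => h.of_range_eq fun e => (hT e).symm, fun h => h.of_range_eq hT⟩

end Reordering

section ProjectiveLine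

theorem bracket_self (x : Fin 2 → ℂ) : bracket x x = 0 := by
  simp only [bracket]
  ring

theorem bracket_smul_smul (a b : ℂ) (x y : Fin 2 → ℂ) :
    bracket (a • x) (b • y) = a * b * bracket x y := by
  simp only [bracket, Pi.smul_apply, smul_eq_mul]
  ring

theorem mk_eq_mk_iff_bracket_eq_zero {x y : Fin 2 → ℂ} (hx : x ≠ 0) (hy : y ≠ 0) :
    Projectivization.mk ℂ x hx = Projectivization.mk ℂ y hy ↔ bracket x y = 0 := by
  constructor
  · rw [Projectivization.mk_eq_mk_iff']
    rintro ⟨a, rfl⟩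
    simpa [bracket_self] using bracket_smul_smul a 1 y y
  · intro h
    obtain ⟨a, ha⟩ := Projectivization.exists_smul_eq_mk_rep ℂ x hx
    obtain ⟨b, hb⟩ := Projectivization.exists_smul_eq_mk_rep ℂ y hy
    by_contra hne
    apply bracket_rep_ne_zero hne
    rw [← ha, ← hb, Units.smul_def, Units.smul_def, bracket_smul_smul, h, mul_zero]

theorem crossRatio_self_second (z₁ z₂ z₃ : P1) : crossRatio z₁ z₂ z₃ z₂ = 0 := by
  rw [crossRatio, bracket_self, mul_zero, zero_div]

theorem crossRatio_self_third {z₁ z₂ z₃ : P1} (h₁₃ : z₁ ≠ z₃) (h₂₃ : z₂ ≠ z₃) :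
    crossRatio z₁ z₂ z₃ z₃ = 1 := by
  rw [crossRatio, mul_comm, div_self]
  exact mul_ne_zero (bracket_rep_ne_zero h₂₃.symm) (bracket_rep_ne_zero h₁₃.symm)

/-- The point `∞` of `ℙ¹`. -/
noncomputable def infinityPoint : P1 :=
  Projectivization.mk ℂ ![1, 0] (by simp)

/-- The complex number `t` as a point of `ℙ¹`. -/
noncomputable def affinePoint (t : ℂ) : P1 :=
  Projectivization.mk ℂ ![t, 1] (by simp)

theorem affinePoint_injective : Function.Injective affinePoint := fun t t' h => by
  simpa [bracket, sub_eq_zero] using (mk_eq_mk_iff_bracket_eq_zero _ _).mp h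

theorem affinePoint_ne_infinityPoint (t : ℂ) : affinePoint t ≠ infinityPoint := fun h => by
  simpa [bracket] using (mk_eq_mk_iff_bracket_eq_zero _ _).mp h

/-- The affine coordinate in which `z₁, z₂, z₃` become `∞, 0, 1` is `u ↦ CR(z₁, z₂, z₃, u)`. -/
theorem exists_smul_affinePoint_crossRatio {z₁ z₂ z₃ : P1} (h₁₂ : z₁ ≠ z₂) (h₁₃ : z₁ ≠ z₃)
    (h₂₃ : z₂ ≠ z₃) : ∃ g : GL (Fin 2) ℂ, g • infinityPoint = z₁ ∧
      ∀ u ≠ z₁, g • affinePoint (crossRatio z₁ z₂ z₃ u) = u := by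
  let a := z₁.rep
  let b := z₂.rep
  let c := z₃.rep
  have hab : bracket a b ≠ 0 := bracket_rep_ne_zero h₁₂
  have hac : bracket a c ≠ 0 := bracket_rep_ne_zero h₁₃
  have hcb : bracket c b ≠ 0 := bracket_rep_ne_zero h₂₃.symm
  -- The columns are multiples of `a` and `b` whose sum is proportional to `c`.
  let A : Matrix (Fin 2) (Fin 2) ℂ :=
    !![bracket c b * a 0, bracket a c * b 0; bracket c b * a 1, bracket a c * b 1]
  have det_A : A.det = bracket c b * bracket a c * bracket a b := by
    simp only [A, Matrix.det_fin_two_of, bracket]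
    ring
  let g : GL (Fin 2) ℂ := Matrix.GeneralLinearGroup.mkOfDetNeZero A
    (det_A ▸ mul_ne_zero (mul_ne_zero hcb hac) hab)
  have bracket_smul (t s : ℂ) (x : Fin 2 → ℂ) :
      bracket (g • ![t, s]) x = t * bracket c b * bracket a x + s * bracket a c * bracket b x := by
    change bracket (A.mulVec ![t, s]) x = _
    simp only [A, bracket, Matrix.mulVec, dotProduct, Fin.sum_univ_two, Matrix.of_apply,
      Matrix.cons_val_zero, Matrix.cons_val_one]
    ring
  refine ⟨g, ?_, fun u hu => ?_⟩
  · rw [← z₁.mk_rep, infinityPoint, Projectivization.smul_mk, mk_eq_mk_iff_bracket_eq_zero,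
      bracket_smul, bracket_self]
    ring
  · have hua : bracket u.rep a ≠ 0 := bracket_rep_ne_zero hu
    have clear_denominators : crossRatio z₁ z₂ z₃ u * bracket c b * bracket u.rep a =
        bracket c a * bracket u.rep b := by
      rw [mul_assoc]
      exact div_mul_cancel₀ _ (mul_ne_zero hcb hua)
    conv_rhs => rw [← u.mk_rep]
    rw [affinePoint, Projectivization.smul_mk, mk_eq_mk_iff_bracket_eq_zero, bracket_smul]
    simp only [bracket] at clear_denominators ⊢
    linear_combination -clear_denominators

theorem crossRatio_injOn {z₁ z₂ z₃ : P1} (h₁₂ : z₁ ≠ z₂) (h₁₃ : z₁ ≠ z₃) (h₂₃ : z₂ ≠ z₃) :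
    Set.InjOn (crossRatio z₁ z₂ z₃) {z₁}ᶜ := by
  obtain ⟨g, -, hg⟩ := exists_smul_affinePoint_crossRatio h₁₂ h₁₃ h₂₃
  intro u hu u' hu' h
  rw [← hg u hu, h, hg u' hu']

theorem exists_snoc_quadCrossRatio_eq (w : Fin 3 ↪ P1) (c : CC) :
    ∃ (u : P1) (hu : u ∉ Set.range w), quadCrossRatio (Fin.Embedding.snoc w hu) = c := by
  have hw {i j : Fin 3} (h : i ≠ j) : w i ≠ w j := w.injective.ne h
  have h₀₂ := hw (by decide : (0 : Fin 3) ≠ 2)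
  have h₁₂ := hw (by decide : (1 : Fin 3) ≠ 2)
  obtain ⟨g, hg_infinity, hg⟩ :=
    exists_smul_affinePoint_crossRatio (hw (by decide : (0 : Fin 3) ≠ 1)) h₀₂ h₁₂
  let u := g • affinePoint c
  have hu₀ : u ≠ w 0 := fun h =>
    affinePoint_ne_infinityPoint c (MulAction.injective g (h.trans hg_infinity.symm))
  have hc : crossRatio (w 0) (w 1) (w 2) u = c :=
    affinePoint_injective (MulAction.injective g (hg u hu₀))
  refine ⟨u, ?_, Subtype.ext hc⟩
  rintro ⟨i, hi⟩
  fin_cases i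
  · exact hu₀ hi.symm
  · exact c.2.1 (hc ▸ hi ▸ crossRatio_self_second (w 0) (w 1) (w 2))
  · exact c.2.2 (hc ▸ hi ▸ crossRatio_self_third h₀₂ h₁₂)

end ProjectiveLine

section Dependence

variable {V W ι : Type*}

/-- Homogeneous coordinates of the points `∞, 0, 1` and of the affine points `t j`: up to a Möbius
transformation, every family of distinct points has this form. -/
def normalCoord (t : W → ℂ) : Fin 3 ⊕ W → Fin 2 → ℂ :=
  Sum.elim ![![1, 0], ![0, 1], ![1, 1]] fun j => ![t j, 1]

theorem normalCoord_ne_zero (t : W → ℂ) (v : Fin 3 ⊕ W) : normalCoord t v ≠ 0 := by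
  rcases v with v | j
  · fin_cases v <;> simp [normalCoord]
  · simp [normalCoord]

theorem exists_eval_eq_normalCoord (v : Fin 3 ⊕ W) (i : Fin 2) :
    ∃ p : MvPolynomial W ℂ, ∀ t, eval t p = normalCoord t v i := by
  rcases v with v | j
  · exact ⟨C (normalCoord (0 : W → ℂ) (.inl v) i), fun t => eval_C (f := t) _⟩
  · fin_cases i
    · exact ⟨X j, fun t => eval_X j⟩
    · exact ⟨1, fun t => map_one _⟩

theorem exists_eval_eq_bracket_normalCoord (v w : Fin 3 ⊕ W) :
    ∃ p : MvPolynomial W ℂ, ∀ t, eval t p = bracket (normalCoord t v) (normalCoord t w) := by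
  choose p hp using exists_eval_eq_normalCoord (W := W)
  exact ⟨p v 0 * p w 1 - p v 1 * p w 0, fun t => by simp only [bracket, map_sub, map_mul, hp]⟩

theorem exists_smul_mk_normalCoord (z : Fin 3 ⊕ W ↪ P1) :
    ∃ (t : W → ℂ) (g : GL (Fin 2) ℂ),
      ∀ v, g • Projectivization.mk ℂ (normalCoord t v) (normalCoord_ne_zero t v) = z v := by
  have hz {v w : Fin 3 ⊕ W} (h : v ≠ w) : z v ≠ z w := z.injective.ne h
  have h₀₂ : z (.inl 0) ≠ z (.inl 2) := hz (by simp)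
  have h₁₂ : z (.inl 1) ≠ z (.inl 2) := hz (by simp)
  obtain ⟨g, hg_infinity, hg⟩ :=
    exists_smul_affinePoint_crossRatio (hz (v := .inl 0) (w := .inl 1) (by simp)) h₀₂ h₁₂
  refine ⟨fun j => crossRatio (z (.inl 0)) (z (.inl 1)) (z (.inl 2)) (z (.inr j)), g, ?_⟩
  rintro (v | j)
  · fin_cases v
    · exact hg_infinity
    · have := hg (z (.inl 1)) (hz (by simp))
      rwa [crossRatio_self_second] at this
    · have := hg (z (.inl 2)) h₀₂.symm
      rwa [crossRatio_self_third h₀₂ h₁₂] at this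
  · exact hg _ (hz (by simp))

theorem exists_relation_crossRatioMap_sum (h : ENat.card W < ENat.card ι)
    (T : ι → (Fin 4 ↪ Fin 3 ⊕ W)) :
    ∃ P : MvPolynomial ι ℂ, P ≠ 0 ∧
      ∀ x : M0 (Fin 3 ⊕ W), eval (fun i => (crossRatioMap T x i : ℂ)) P = 0 := by
  choose B hB using exists_eval_eq_bracket_normalCoord (W := W)
  obtain ⟨P, hP, hP0⟩ := exists_relation_of_card_lt h
    (fun i => B (T i 2) (T i 0) * B (T i 3) (T i 1))
    (fun i => B (T i 2) (T i 1) * B (T i 3) (T i 0))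
  refine ⟨P, hP, fun x => ?_⟩
  induction x using Quotient.inductionOn with | h z => ?_
  obtain ⟨t, g, hg⟩ := exists_smul_mk_normalCoord z
  have bracket_ne_zero {v w : Fin 3 ⊕ W} (h : v ≠ w) :
      bracket (normalCoord t v) (normalCoord t w) ≠ 0 := fun h0 => by
    refine h (z.injective ?_)
    rw [← hg, ← hg, (mk_eq_mk_iff_bracket_eq_zero (normalCoord_ne_zero t v)
      (normalCoord_ne_zero t w)).mpr h0]
  have crossRatio_eq (i : ι) : (quadCrossRatio ((T i).trans z) : ℂ) =
      bracket (normalCoord t (T i 2)) (normalCoord t (T i 0)) *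
          bracket (normalCoord t (T i 3)) (normalCoord t (T i 1)) /
        (bracket (normalCoord t (T i 2)) (normalCoord t (T i 1)) *
          bracket (normalCoord t (T i 3)) (normalCoord t (T i 0))) := by
    simp only [quadCrossRatio, Function.Embedding.trans_apply, ← hg, crossRatio_smul, crossRatio_mk]
  simpa only [crossRatioMap_mk, crossRatio_eq, map_mul, hB] using hP0 t fun i => by
    rw [map_mul, hB, hB]
    exact mul_ne_zero (bracket_ne_zero ((T i).injective.ne (by decide)))
      (bracket_ne_zero ((T i).injective.ne (by decide)))

/-- The map `M_{0,W} → M_{0,V}` that keeps only the points with index in `V`. -/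
noncomputable def restrict (i : V ↪ W) : M0 W → M0 V :=
  Quotient.map' (fun z => i.trans z) fun _ _ ⟨g, hg⟩ => ⟨g, hg ▸ rfl⟩

theorem crossRatioMap_restrict (T : ι → (Fin 4 ↪ V)) (i : V ↪ W) (x : M0 W) :
    crossRatioMap T (restrict i x) = crossRatioMap (fun e => (T e).trans i) x := by
  induction x using Quotient.inductionOn with | h z => rfl

theorem exists_relation_crossRatioMap (s : Fin 3 ↪ V) (h : ENat.card V < ENat.card ι + 3)
    (T : ι → (Fin 4 ↪ V)) :
    ∃ P : MvPolynomial ι ℂ, P ≠ 0 ∧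
      ∀ x : M0 V, eval (fun i => (crossRatioMap T x i : ℂ)) P = 0 := by
  classical
  let ε : Fin 3 ⊕ ↥(Set.range s)ᶜ ≃ V :=
    ((Equiv.ofInjective s s.injective).sumCongr (Equiv.refl _)).trans (Equiv.Set.sumCompl _)
  have hcard : ENat.card ↥(Set.range s)ᶜ < ENat.card ι := by
    rwa [← ENat.card_congr ε, ENat.card_sum, add_comm, ENat.card_eq_coe_fintype_card (α := Fin 3),
      Fintype.card_fin, Nat.cast_ofNat, ENat.add_lt_add_iff_right (by simp)] at h
  obtain ⟨P, hP, hP0⟩ := exists_relation_crossRatioMap_sum hcard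
    fun i => (T i).trans ε.symm.toEmbedding
  refine ⟨P, hP, fun x => ?_⟩
  simpa [crossRatioMap_restrict, Function.Embedding.trans_assoc] using
    hP0 (restrict ε.toEmbedding x)

end Dependence

section Extension

variable {V E : Type*}

/-- The hypergraph `T` with the additional hyperedge `(s 0, s 1, s 2, v)`, indexed by `none`. -/
def addEdge (s : Fin 3 ↪ V) {v : V} (hv : v ∉ Set.range s) (T : E → (Fin 4 ↪ V)) :
    Option E → (Fin 4 ↪ V) :=
  fun o => o.elim (Fin.Embedding.snoc s hv) T

/-- The hypergraph `T` with the new vertex `none` and the new hyperedge `(s 0, s 1, s 2, none)`,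
also indexed by `none`. -/
def addVertex (s : Fin 3 ↪ V) (T : E → (Fin 4 ↪ V)) : Option E → (Fin 4 ↪ Option V) :=
  addEdge (v := none) (s.trans .some) (by simp) fun e => (T e).trans .some

theorem exists_collision_polynomial [Finite V] (h : ENat.card V ≤ ENat.card E + 3)
    (s : Fin 3 ↪ V) (T : E → (Fin 4 ↪ V)) :
    ∃ B : MvPolynomial (Option E) ℂ, B ≠ 0 ∧ ∀ (v : V) (hv : v ∉ Set.range s) (x : M0 V),
      eval (fun o => (crossRatioMap (addEdge s hv T) x o : ℂ)) B = 0 := by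
  have hcard : ENat.card V < ENat.card (Option E) + 3 := by
    have card_option : ENat.card (Option E) = ENat.card E + 1 := by
      simp [ENat.card, Cardinal.mk_option]
    rw [card_option, add_right_comm]
    exact (ENat.lt_add_one_iff' (ENat.card_lt_top_of_finite).ne).mpr h
  choose B hB hB0 using fun v : {v // v ∉ Set.range s} =>
    exists_relation_crossRatioMap s hcard (addEdge s v.2 T)
  have := Fintype.ofFinite {v // v ∉ Set.range s}
  refine ⟨∏ v, B v, Finset.prod_ne_zero_iff.mpr fun v _ => hB v, fun v hv x => ?_⟩
  rw [map_prod]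
  exact Finset.prod_eq_zero (Finset.mem_univ ⟨v, hv⟩) (hB0 ⟨v, hv⟩ x)

variable {s : Fin 3 ↪ V} {T : E → (Fin 4 ↪ V)} {a : Option E → CC}

theorem mapsTo_restrict_some :
    Set.MapsTo (restrict .some) (crossRatioMap (addVertex s T) ⁻¹' {a})
      (crossRatioMap T ⁻¹' {a ∘ some}) := by
  rintro x rfl
  exact (crossRatioMap_restrict T .some x).trans (crossRatioMap_comp (addVertex s T) some x)

theorem injOn_restrict_some :
    Set.InjOn (restrict .some) (crossRatioMap (addVertex s T) ⁻¹' {a}) := by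
  intro x hx y hy hxy
  induction x using Quotient.inductionOn with | h z => ?_
  induction y using Quotient.inductionOn with | h w => ?_
  obtain ⟨g, hg⟩ := Quotient.exact hxy
  have hgw (v : V) : g • w (some v) = z (some v) := DFunLike.congr_fun hg v
  have hz {v v' : Option V} (h : v ≠ v') : z v ≠ z v' := z.injective.ne h
  have hs {i j : Fin 3} (h : i ≠ j) : z (some (s i)) ≠ z (some (s j)) := hz (by simpa)
  have hgw_none : g • w none ≠ z (some (s 0)) := by
    rw [← hgw]
    exact (MulAction.injective g).ne (w.injective.ne (by simp))
  have crossRatio_eq : crossRatio (z (some (s 0))) (z (some (s 1))) (z (some (s 2))) (g • w none) =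
      crossRatio (z (some (s 0))) (z (some (s 1))) (z (some (s 2))) (z none) := by
    rw [← hgw, ← hgw, ← hgw, crossRatio_smul, hgw, hgw, hgw]
    exact congrArg Subtype.val ((congrFun hy none).trans (congrFun hx none).symm)
  have hgw' : g • w none = z none :=
    crossRatio_injOn (hs (by decide)) (hs (by decide)) (hs (by decide)) hgw_none (hz (by simp))
      crossRatio_eq
  refine Quotient.sound ⟨g, DFunLike.ext _ _ fun v => ?_⟩
  cases v with
  | some v => exact hgw v
  | none => exact hgw'

theorem surjOn_restrict_some
    (ha : ∀ (v : V) (hv : v ∉ Set.range s), a ∉ Set.range (crossRatioMap (addEdge s hv T))) :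
    Set.SurjOn (restrict .some) (crossRatioMap (addVertex s T) ⁻¹' {a})
      (crossRatioMap T ⁻¹' {a ∘ some}) := by
  intro y hy
  induction y using Quotient.inductionOn with | h z => ?_
  obtain ⟨u, hu, hua⟩ := exists_snoc_quadCrossRatio_eq (s.trans z) (a none)
  have hzu : u ∉ Set.range z := by
    rintro ⟨v, rfl⟩
    have hv : v ∉ Set.range s := fun ⟨i, hi⟩ => hu ⟨i, congrArg z hi⟩
    refine ha v hv ⟨Quotient.mk _ z, funext fun o => ?_⟩
    cases o with
    | none => exact hua
    | some e => exact congrFun hy e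
  refine ⟨Quotient.mk _ (z.optionElim u hzu), funext fun o => ?_, rfl⟩
  cases o with
  | none => exact hua
  | some e => exact congrFun hy e

theorem encard_fibre_addVertex
    (ha : ∀ (v : V) (hv : v ∉ Set.range s), a ∉ Set.range (crossRatioMap (addEdge s hv T))) :
    {x | crossRatioMap (addVertex s T) x = a}.encard =
      {y | crossRatioMap T y = a ∘ some}.encard :=
  Set.encard_congr <| Set.BijOn.equiv (restrict .some)
    ⟨mapsTo_restrict_some, injOn_restrict_some, surjOn_restrict_some ha⟩

theorem isDegree_addVertex_iff [Finite V] (h : ENat.card V ≤ ENat.card E + 3)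
    (s : Fin 3 ↪ V) (T : E → (Fin 4 ↪ V)) (d : ℕ) :
    IsDegree (addVertex s T) d ↔ IsDegree T d := by
  obtain ⟨B, hB, hB0⟩ := exists_collision_polynomial h s T
  have encard_eq {a : Option E → CC} (ha : eval (fun o => (a o : ℂ)) B ≠ 0) :=
    encard_fibre_addVertex (s := s) (T := T) (a := a) <| by
      rintro v hv ⟨x, rfl⟩
      exact ha (hB0 v hv x)
  constructor
  · rintro ⟨q, hq, hd⟩
    obtain ⟨p, hp, hpq⟩ :=
      exists_eval_elim_ne_zero infinite_setOf_ne_zero_and_ne_one (mul_ne_zero hq hB)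
    refine ⟨p, hp, fun a ha => ?_⟩
    obtain ⟨b, hb, hab⟩ := hpq _ ha
    let a' : Option E → CC := fun o => o.elim ⟨b, hb⟩ a
    have coe_a' : (fun o => (a' o : ℂ)) = fun o => o.elim b fun e => (a e : ℂ) := by
      funext o
      cases o <;> rfl
    rw [← coe_a', map_mul] at hab
    rw [← hd a' (left_ne_zero_of_mul hab)]
    exact (encard_eq (right_ne_zero_of_mul hab)).symm
  · rintro ⟨p, hp, hd⟩
    have hp' : rename some p ≠ 0 :=
      ((rename_injective _ (Option.some_injective E)).ne_iff' (map_zero _)).mpr hp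
    refine ⟨rename some p * B, mul_ne_zero hp' hB, fun a ha => ?_⟩
    rw [map_mul, eval_rename] at ha
    rw [encard_eq (right_ne_zero_of_mul ha)]
    exact hd (a ∘ some) (left_ne_zero_of_mul ha)

end Extension

theorem crossRatioDegree_congr {V V' E E' : Type*} {T : E → (Fin 4 ↪ V)}
    {T' : E' → (Fin 4 ↪ V')} (h : ∀ d, IsDegree T d ↔ IsDegree T' d) :
    crossRatioDegree T = crossRatioDegree T' := by
  have isDegree_eq : IsDegree T = IsDegree T' := funext fun d => propext (h d)
  unfold crossRatioDegree
  rw [isDegree_eq]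

end CrossRatioDegree

open CrossRatioDegree in
theorem lemma3p2_general {V E : Type*} [Finite V] (hcard : ENat.card V ≤ ENat.card E + 3)
    (T : E → (Fin 4 ↪ V)) (v₁ v₂ v₃ : V) (h₁₂ : v₁ ≠ v₂) (h₁₃ : v₁ ≠ v₃) (h₂₃ : v₂ ≠ v₃)
    (T' : Option E → (Fin 4 ↪ Option V))
    (hold : ∀ e : E, Set.range (T' (some e)) = some '' Set.range (T e))
    (hnew : Set.range (T' none) = {some v₁, some v₂, some v₃, none}) :
    crossRatioDegree T = crossRatioDegree T' := by
  have injective : Function.Injective ![v₁, v₂, v₃] := by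
    intro i j
    fin_cases i <;> fin_cases j <;> simp [h₁₂, h₁₃, h₂₃, h₁₂.symm, h₁₃.symm, h₂₃.symm]
  let s : Fin 3 ↪ V := ⟨![v₁, v₂, v₃], injective⟩
  have range_eq (o : Option E) : Set.range (addVertex s T o) = Set.range (T' o) := by
    cases o with
    | some e => exact (Set.range_comp some (T e)).trans (hold e).symm
    | none =>
      rw [hnew]
      change Set.range (Fin.snoc (some ∘ ![v₁, v₂, v₃]) none : Fin 4 → Option V) = _
      rw [Fin.range_snoc, Set.range_comp]
      ext v
      simp only [Matrix.range_cons, Matrix.range_empty, Set.union_empty, Set.singleton_union,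
        Set.image_insert_eq, Set.image_singleton, Set.mem_insert_iff, Set.mem_singleton_iff]
      tauto
  exact crossRatioDegree_congr fun d =>
    (isDegree_addVertex_iff hcard s T d).symm.trans (isDegree_congr_of_range_eq range_eq d)

theorem lemma3p2 {V E : Type*} [Fintype V] [Fintype E]
    (hcard : Fintype.card V = Fintype.card E + 3)
    (T : E → (Fin 4 ↪ V)) (v₁ v₂ v₃ : V) (h₁₂ : v₁ ≠ v₂) (h₁₃ : v₁ ≠ v₃) (h₂₃ : v₂ ≠ v₃)
    (T' : Option E → (Fin 4 ↪ Option V))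
    (hold : ∀ e : E, Set.range (T' (some e)) = some '' Set.range (T e))
    (hnew : Set.range (T' none) = {some v₁, some v₂, some v₃, none}) :
    CrossRatioDegree.crossRatioDegree T = CrossRatioDegree.crossRatioDegree T' :=
  lemma3p2_general (by simp [hcard]) T v₁ v₂ v₃ h₁₂ h₁₃ h₂₃ T' hold hnew
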